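/- Let $[n]=\{1,\dots,n\}$. For a set partition $\Pi$ of $[n]$, let $\mathrm{Flatten}(\Pi)$ be the permutation of $[n]$ obtained by writing the entries of each block in increasing order, listing the blocks in increasing order of their first entries, and erasing the dividers between blocks. Let $\mathcal U(n;321)$ be the set of partitions $\Pi$ of $[n]$ for which $\mathrm{Flatten}(\Pi)$ avoids the pattern $321$. A right-to-left minimum of a permutation is an entry smaller than all entries after it; a descent terminator is an entry that is either the first entry or smaller than its immediate predecessor. Let $M(\Pi)$ be the set of right-to-left minima of $\mathrm{Flatten}(\Pi)$ that are not descent terminators, and let $\mathcal U(n,k;321)=\{\Pi\in\mathcal U(n;321): |M(\Pi)|=k\}$. Let $C_n$ be the $n$-th Catalan number and let $R_n=\sum_{j=0}^n(-1)^{n-j}\binom nj C_j$ be the $n$-th Riordan number. Then for every integer $n\ge 0$: 1. $\displaystyle|\mathcal U(n+1;321)|=\sum_{k=0}^n\binom nk C_k$; 2. $\displaystyle|\mathcal U(n+1,k;321)|=\binom nk 2^k R_{n-k}$ for $0\le k\le n$; 3. $|\mathcal U(n+1,0;321)|$ equals the number of Dyck $n$-paths (paths with $n$ upsteps and $n$ downsteps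 that never go below their starting level) with no short descents, that is, in which no maximal run of consecutive downsteps has length $1$; 4. $\displaystyle\sum_{k=0}^n\binom nk 2^kR_{n-k}=\sum_{k=0}^n\binom nk C_k$. -/

import Mathlib

namespace FlattenedPartition

/-- The set `[n] = {1, 2, …, n}`. -/
abbrev interval (n : ℕ) : Finset ℕ := Finset.Icc 1 n

/-- The block initiators of a partition of `[n]`: the elements that are the smallest entry of
their block. -/
def initiators {n : ℕ} (P : Finpartition (interval n)) : Finset ℕ :=
  (interval n).filter fun a => ∀ b ∈ P.part a, a ≤ b

/-- The standard increasing form of a partition: the entries of each block are listed increasingly,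
and the blocks are listed in increasing order of their first (that is, smallest) entries. -/
def standardForm {n : ℕ} (P : Finpartition (interval n)) : List (List ℕ) :=
  ((initiators P).sort (· ≤ ·)).map fun a => (P.part a).sort (· ≤ ·)

/-- The permutation of `[n]` (as a word) obtained by erasing the dividers between the blocks of the
standard increasing form. -/
def flatten {n : ℕ} (P : Finpartition (interval n)) : List ℕ :=
  (standardForm P).flatten

/-- The word `w` contains the pattern `π`: some subsequence of `w` has the same length as `π` and
its entries are in the same relative order as those of `π`. -/
def Contains (w π : List ℕ) : Prop :=
  ∃ f : Fin π.length ↪o Fin w.length,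
    ∀ i j : Fin π.length, w.get (f i) < w.get (f j) ↔ π.get i < π.get j

/-- `U(n; π)`: the partitions of `[n]` whose flattening avoids the pattern `π`. -/
def U (n : ℕ) (π : List ℕ) : Set (Finpartition (interval n)) :=
  {P | ¬ Contains (flatten P) π}

/-- `a` is a right-to-left minimum of `w`: it is an entry of `w` that is smaller than all the
entries after it. -/
def IsRLMin (w : List ℕ) (a : ℕ) : Prop :=
  ∃ u v : List ℕ, w = u ++ a :: v ∧ ∀ b ∈ v, a < b

/-- `a` is a descent terminator of `w`: it is an entry of `w` that is either the first entry or
smaller than its immediate predecessor. -/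
def IsDescentTerminator (w : List ℕ) (a : ℕ) : Prop :=
  ∃ u v : List ℕ, w = u ++ a :: v ∧ (u = [] ∨ ∃ b, u.getLast? = some b ∧ a < b)

/-- `M(P)`: the right-to-left minima of the flattening that are not descent terminators. -/
def M {n : ℕ} (P : Finpartition (interval n)) : Set ℕ :=
  {a | IsRLMin (flatten P) a ∧ ¬ IsDescentTerminator (flatten P) a}

/-- `U(n, k; π)`: the members `P` of `U(n; π)` with `|M(P)| = k`. -/
def UM (n k : ℕ) (π : List ℕ) : Set (Finpartition (interval n)) :=
  {P | P ∈ U n π ∧ (M P).ncard = k}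

/-- The Riordan numbers `R_n = ∑_{j=0}^n (-1)^(n-j) (n choose j) C_j`. -/
def riordan (n : ℕ) : ℤ :=
  ∑ j ∈ Finset.range (n + 1), (-1) ^ (n - j) * (n.choose j : ℤ) * (catalan j : ℤ)

/-- A Dyck path has no short descent: no downstep forms by itself a maximal run of contiguous
downsteps, that is, every downstep has a downstep next to it. -/
def NoShortDescents (p : DyckWord) : Prop :=
  ∀ u v : List DyckStep, p.toList = u ++ DyckStep.D :: v →
    u.getLast? = some DyckStep.D ∨ v.head? = some DyckStep.D

/-- The Dyck `n`-paths (`n` upsteps and `n` downsteps) with no short descents. -/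
def noShortDescentPaths (n : ℕ) : Set DyckWord :=
  {p | p.semilength = n ∧ NoShortDescents p}

end FlattenedPartition

/-!
The word `flatten P` of a partition `P` of `[n + 1]` starts with `1`, and the block initiators of
`P` form a set of right-to-left minima of this word that contains all its descent terminators.
Conversely, a word together with any such set of letters comes from exactly one partition: cut the
word before the chosen letters (`eq_of_flatten_eq`, `exists_flatten_eq_initiators_eq`). Hence a word
all of whose descent terminators are right-to-left minima is the flattening of `2 ^ k` partitions,
where `k` is the number of its right-to-left minima that are not descent terminators
(`ncard_flatten_eq`). If the word avoids 321, the condition on descent terminators says only that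
its first letter is `1`; what remains are the words `1 :: w` with `w` an arbitrary 321-avoiding
arrangement of `2, …, n + 1` (`flattenings_eq`).

Such a `w` is encoded by a list of natural numbers, one for each letter in increasing order: the
entry of a right-to-left minimum is the distance from the previous right-to-left minimum to it, and
the entry of any other letter is `0`. The lists that arise are those of length `n` and sum `n` in
which no suffix has a sum exceeding its length, and the statistic `k` becomes the number of entries
`1`. The bijection is built by adding the letters in decreasing order (`bijOn_decode`,
`length_minima_decode`). Reading such a list backwards, with an entry `x` standing for an upstep
followed by `x` downsteps, gives a Dyck path whose short descents are the entries `1`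
(`bijOn_codePath`, `one_notMem_iff`). So there are Catalan many lists in all, and those without
entries `1` correspond to the Dyck paths with no short descents.

An entry `1` does not affect the balance of length and sum, so entries `1` can be inserted and
deleted freely. Hence there are `n.choose k * r (n - k)` lists of length `n` with `k` entries `1`,
where `r` counts the lists without entries `1` (`ncard_codes_count_one`). Summing over `k` gives
`catalan n = ∑ k, n.choose k * r k`, and binomial inversion identifies `r` with the Riordan numbers
(`ncard_codes_no_one`). The total count then follows from the identity
`sum_choose_mul_two_pow_mul_riordan`.
-/

/-! ### Ballot codes and Dyck paths -/

namespace BallotCode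

open DyckStep

/-- A list of natural numbers is a ballot code when the sum of each of its suffixes is at most the
length of that suffix. -/
def Ballot : List ℕ → Prop
  | [] => True
  | x :: l => x + l.sum ≤ l.length + 1 ∧ Ballot l

theorem Ballot.sum_le_length {l : List ℕ} (h : Ballot l) : l.sum ≤ l.length := by
  cases l with
  | nil => simp
  | cons x l => simpa using h.1

/-- The balanced ballot codes of length `n`: lists of `n` natural numbers with sum `n`, all of
whose suffix sums are at most the suffix lengths. -/
def codes (n : ℕ) : Set (List ℕ) :=
  {l | l.length = n ∧ Ballot l ∧ l.sum = n}

/-- The lattice path of a code: reading the code from the right, each entry `x` contributes an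
upstep followed by `x` downsteps. -/
def codePath : List ℕ → List DyckStep
  | [] => []
  | x :: l => codePath l ++ U :: List.replicate x D

/-- The code of a lattice path, read off from left to right: an upstep opens a new entry and a
downstep increments the current one. -/
def pathCode (p : List DyckStep) : List ℕ :=
  p.foldl (fun l s => match s, l with
    | U, l => 0 :: l
    | D, x :: l => (x + 1) :: l
    | D, [] => []) []

theorem pathCode_codePath (l : List ℕ) : pathCode (codePath l) = l := by
  induction l with
  | nil => rfl
  | cons x l ih =>
    have key : ∀ x y : ℕ, ∀ m : List ℕ, (List.replicate x D).foldl (fun l s => match s, l with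
        | U, l => 0 :: l
        | D, x :: l => (x + 1) :: l
        | D, [] => []) (y :: m) = (y + x) :: m := by
      intro x
      induction x with
      | zero => intros; rfl
      | succ x ihx =>
        intro y m
        rw [List.replicate_succ, List.foldl_cons]
        exact (ihx (y + 1) m).trans (by congr 1; omega)
    unfold pathCode at ih ⊢
    rw [codePath, List.foldl_append, ih, List.foldl_cons]
    exact (key x 0 l).trans (by simp)

theorem codePath_append (l m : List ℕ) : codePath (l ++ m) = codePath m ++ codePath l := by
  induction l with
  | nil => simp [codePath]
  | cons x l ih => simp [codePath, ih]

theorem count_U_codePath (l : List ℕ) : (codePath l).count U = l.length := by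
  induction l with
  | nil => rfl
  | cons x l ih => simp [codePath, ih, List.count_replicate]

theorem count_D_codePath (l : List ℕ) : (codePath l).count D = l.sum := by
  induction l with
  | nil => rfl
  | cons x l ih => simp [codePath, ih, add_comm]

/-- The path never goes below its starting level. -/
def StaysNonneg (p : List DyckStep) : Prop :=
  ∀ i, (p.take i).count D ≤ (p.take i).count U

theorem staysNonneg_concat (p : List DyckStep) (s : DyckStep) :
    StaysNonneg (p ++ [s]) ↔ StaysNonneg p ∧ (p ++ [s]).count D ≤ (p ++ [s]).count U := by
  refine ⟨fun h => ⟨fun i => ?_, ?_⟩, fun h i => ?_⟩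
  · rcases le_total i p.length with hi | hi
    · simpa [List.take_append_of_le_length hi] using h i
    · simpa [List.take_of_length_le hi] using h p.length
  · have := h (p.length + 1)
    rwa [List.take_of_length_le (by simp)] at this
  · rcases Nat.lt_or_ge p.length i with hi | hi
    · rw [List.take_of_length_le (by simpa using hi)]
      exact h.2
    · rw [List.take_append_of_le_length hi]
      exact h.1 i

theorem staysNonneg_append_replicate {p : List DyckStep} (hp : StaysNonneg p) (x : ℕ) :
    StaysNonneg (p ++ List.replicate x D) ↔ p.count D + x ≤ p.count U := by
  induction x with
  | zero => simpa [hp] using by simpa using hp p.length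
  | succ x ih =>
    rw [List.replicate_succ', ← List.append_assoc, staysNonneg_concat, ih]
    simp [List.count_replicate]
    omega

theorem staysNonneg_codePath (l : List ℕ) : StaysNonneg (codePath l) ↔ Ballot l := by
  induction l with
  | nil => simp [StaysNonneg, codePath, Ballot]
  | cons x l ih =>
    have hcons : codePath (x :: l) = (codePath l ++ [U]) ++ List.replicate x D := by
      simp [codePath]
    have hU : StaysNonneg (codePath l ++ [U]) ↔ Ballot l := by
      rw [staysNonneg_concat, ih]
      refine and_iff_left_of_imp fun h => ?_
      have := h.sum_le_length
      simp [count_U_codePath, count_D_codePath]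
      omega
    -- The last upstep never violates the condition, so only the final run of downsteps matters.
    by_cases hl : Ballot l
    · rw [hcons, staysNonneg_append_replicate (hU.2 hl)]
      simp [count_U_codePath, count_D_codePath, Ballot, hl, add_comm]
    · simp only [Ballot, hl, and_false, iff_false, hcons]
      intro h
      refine hl (hU.1 fun i => ?_)
      rcases le_total i (codePath l ++ [U]).length with hi | hi
      · simpa only [List.take_append_of_le_length hi] using h i
      · have := h (codePath l ++ [U]).length
        rwa [List.take_left, ← List.take_of_length_le hi] at this

theorem exists_codePath_eq {p : List DyckStep} (hp : StaysNonneg p) : ∃ l, codePath l = p := by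
  induction p using List.reverseRecOn with
  | nil => exact ⟨[], rfl⟩
  | append_singleton p s ih =>
    rw [staysNonneg_concat] at hp
    obtain ⟨l, rfl⟩ := ih hp.1
    cases s with
    | U => exact ⟨0 :: l, rfl⟩
    | D =>
      cases l with
      | nil => simp [codePath] at hp
      | cons x l => exact ⟨(x + 1) :: l, by simp [codePath, List.replicate_succ']⟩

/-- A balanced code is the same thing as a Dyck path. -/
theorem bijOn_codePath (n : ℕ) :
    Set.BijOn (fun p : DyckWord => pathCode p.toList) {p | p.semilength = n} (codes n) := by
  refine ⟨fun p hp => ?_, fun p hp q hq h => ?_, fun l hl => ?_⟩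
  · obtain ⟨l, hl⟩ := exists_codePath_eq p.count_D_le_count_U
    have hU := p.count_U_eq_count_D
    have hs : p.toList.count U = n := hp
    have hb := (staysNonneg_codePath l).1 (hl ▸ p.count_D_le_count_U)
    rw [← hl, count_U_codePath] at hU hs
    rw [count_D_codePath] at hU
    simp only [← hl, pathCode_codePath]
    exact ⟨hs, hb, hU ▸ hs⟩
  · obtain ⟨l, hl⟩ := exists_codePath_eq p.count_D_le_count_U
    obtain ⟨m, hm⟩ := exists_codePath_eq q.count_D_le_count_U
    simp only [← hl, ← hm, pathCode_codePath] at h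
    exact DyckWord.ext (by rw [← hl, ← hm, h])
  · obtain ⟨h1, h2, h3⟩ := hl
    refine ⟨⟨codePath l, ?_, (staysNonneg_codePath l).2 h2⟩, ?_, pathCode_codePath l⟩
    · rw [count_U_codePath, count_D_codePath, h1, h3]
    · exact (count_U_codePath l).trans h1

/-- The entries `1` of a code are the short descents of its path. -/
theorem one_notMem_iff (l : List ℕ) :
    1 ∉ l ↔ ∀ u v : List DyckStep, codePath l = u ++ D :: v →
      u.getLast? = some D ∨ v.head? = some D := by
  constructor
  · induction l with
    | nil => intro _ u v h; simp [codePath] at h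
    | cons x l ih =>
      intro h1 u v h
      simp only [List.mem_cons, not_or] at h1
      rw [codePath, List.append_eq_append_iff] at h
      rcases h with ⟨u', rfl, h⟩ | ⟨v', hp, h⟩
      · rcases u' with - | ⟨s, u'⟩
        · simp at h
        · simp only [List.cons_append, List.cons.injEq] at h
          obtain ⟨rfl, h⟩ := h
          have hD : ∀ d ∈ u' ++ D :: v, d = D := fun d hd => List.eq_of_mem_replicate (h ▸ hd)
          rcases v with - | ⟨d, v⟩
          · left
            rcases List.eq_nil_or_concat u' with rfl | ⟨u'', d, rfl⟩
            · exact absurd (by simpa using congrArg List.length h) (Ne.symm h1.1)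
            · rw [hD d (by simp), List.concat_eq_append, ← List.cons_append, ← List.append_assoc]
              exact List.getLast?_concat ..
          · right
            rw [hD d (by simp)]
            rfl
      · rcases v' with - | ⟨s, v'⟩
        · simp at h
        · simp only [List.cons_append, List.cons.injEq] at h
          obtain ⟨rfl, rfl⟩ := h
          rcases ih h1.2 u v' hp with h | h
          · exact .inl h
          · right
            simp [h]
  · intro h hmem
    obtain ⟨l₁, l₂, rfl⟩ := List.append_of_mem hmem
    have hhead : (codePath l₁).head? ≠ some D := by
      clear h hmem
      induction l₁ with
      | nil => simp [codePath]
      | cons x l ih =>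
        rw [codePath]
        cases hl : codePath l with
        | nil => simp
        | cons s p => simpa [hl] using ih
    have := h (codePath l₂ ++ [U]) (codePath l₁) (by simp [codePath_append, codePath])
    simp [hhead] at this

theorem ncard_codes (n : ℕ) : (codes n).ncard = catalan n := by
  rw [← (bijOn_codePath n).image_eq, (bijOn_codePath n).injOn.ncard_image,
    ← DyckWord.card_dyckWord_semilength_eq_catalan n, ← Nat.card_eq_fintype_card]
  rfl

theorem ncard_noShortDescentPaths (n : ℕ) :
    (FlattenedPartition.noShortDescentPaths n).ncard = {l ∈ codes n | l.count 1 = 0}.ncard := by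
  have h := bijOn_codePath n
  have key : Set.BijOn (fun p : DyckWord => pathCode p.toList)
      (FlattenedPartition.noShortDescentPaths n) {l ∈ codes n | l.count 1 = 0} := by
    have hns : ∀ p : DyckWord, FlattenedPartition.NoShortDescents p ↔
        (pathCode p.toList).count 1 = 0 := by
      intro p
      obtain ⟨l, hl⟩ := exists_codePath_eq p.count_D_le_count_U
      rw [List.count_eq_zero, ← hl, pathCode_codePath, one_notMem_iff, hl]
      rfl
    refine ⟨fun p hp => ⟨h.mapsTo hp.1, (hns p).1 hp.2⟩, h.injOn.mono fun p hp => hp.1, ?_⟩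
    rintro l ⟨hl, h1⟩
    obtain ⟨p, hp, rfl⟩ := h.surjOn hl
    exact ⟨p, ⟨hp, (hns p).2 h1⟩, rfl⟩
  rw [← key.image_eq, key.injOn.ncard_image]

end BallotCode

/-! ### Counting codes by their entries `1` -/

theorem Set.ncard_eq_mul_of_fibers {α β : Type*} {S : Set α} {T : Set β} (hS : S.Finite)
    (hT : T.Finite) {f : α → β} (hf : Set.MapsTo f S T) {c : ℕ}
    (h : ∀ b ∈ T, {a ∈ S | f a = b}.ncard = c) : S.ncard = c * T.ncard := by
  classical
  lift S to Finset α using hS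
  lift T to Finset β using hT
  rw [Set.ncard_coe_finset, Set.ncard_coe_finset, Finset.card_eq_sum_card_fiberwise hf,
    Finset.sum_const_nat (m := c), mul_comm]
  intro b hb
  rw [← h b hb, ← Set.ncard_coe_finset]
  simp

theorem Set.ncard_eq_sum_range {α : Type*} {S : Set α} (hS : S.Finite) {f : α → ℕ} {n : ℕ}
    (hf : ∀ a ∈ S, f a ≤ n) :
    S.ncard = ∑ k ∈ Finset.range (n + 1), {a ∈ S | f a = k}.ncard := by
  classical
  lift S to Finset α using hS
  rw [Set.ncard_coe_finset, Finset.card_eq_sum_card_fiberwise (t := Finset.range (n + 1)) (f := f)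
    fun a ha => by simpa [Nat.lt_succ_iff] using hf a ha]
  refine Finset.sum_congr rfl fun b _ => ?_
  rw [← Set.ncard_coe_finset]
  simp

namespace BallotCode

/-- The lists obtained from `l₀` by inserting `k` entries `1`. -/
def insertOnes (l₀ : List ℕ) (k : ℕ) : Set (List ℕ) :=
  {l | l.filter (· ≠ 1) = l₀ ∧ l.count 1 = k}

theorem insertOnes_nil (k : ℕ) : insertOnes [] k = {List.replicate k 1} := by
  ext l
  simp only [insertOnes, Set.mem_ofPred_eq, Set.mem_singleton_iff, List.eq_replicate_iff]
  constructor
  · rintro ⟨h, rfl⟩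
    have h1 : ∀ b ∈ l, b = 1 := by simpa [List.filter_eq_nil_iff] using h
    exact ⟨(List.count_eq_length.2 fun b hb => (h1 b hb).symm).symm, h1⟩
  · rintro ⟨rfl, h⟩
    exact ⟨by simpa [List.filter_eq_nil_iff] using h,
      List.count_eq_length.2 fun b hb => (h b hb).symm⟩

theorem insertOnes_zero {l₀ : List ℕ} (h : 1 ∉ l₀) : insertOnes l₀ 0 = {l₀} := by
  ext l
  simp only [insertOnes, Set.mem_ofPred_eq, Set.mem_singleton_iff, List.count_eq_zero]
  constructor
  · rintro ⟨rfl, h1⟩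
    exact (List.filter_eq_self.2 fun b hb => by simpa using ne_of_mem_of_not_mem hb h1).symm
  · rintro rfl
    exact ⟨List.filter_eq_self.2 fun b hb => by simpa using ne_of_mem_of_not_mem hb h, h⟩

theorem insertOnes_cons_succ {x : ℕ} (hx : x ≠ 1) (l₀ : List ℕ) (k : ℕ) :
    insertOnes (x :: l₀) (k + 1)
      = List.cons 1 '' insertOnes (x :: l₀) k ∪ List.cons x '' insertOnes l₀ (k + 1) := by
  ext l
  simp only [insertOnes, Set.mem_ofPred_eq, Set.mem_union, Set.mem_image]
  constructor
  · rintro ⟨h, hk⟩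
    rcases l with - | ⟨y, l⟩
    · simp at h
    · by_cases hy : y = 1
      · subst hy
        exact .inl ⟨l, ⟨by simpa using h, by simpa using hk⟩, rfl⟩
      · rw [List.filter_cons_of_pos (by simpa using hy), List.cons.injEq] at h
        rw [List.count_cons_of_ne hy] at hk
        exact .inr ⟨l, ⟨h.2, hk⟩, by rw [h.1]⟩
  · rintro (⟨l, ⟨h, hk⟩, rfl⟩ | ⟨l, ⟨h, hk⟩, rfl⟩)
    · exact ⟨by simpa using h, by simpa using hk⟩
    · exact ⟨by rw [List.filter_cons_of_pos (by simpa using hx), h],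
        by rwa [List.count_cons_of_ne hx]⟩

theorem finite_insertOnes_and_ncard (l₀ : List ℕ) (h : 1 ∉ l₀) (k : ℕ) :
    (insertOnes l₀ k).Finite ∧ (insertOnes l₀ k).ncard = (l₀.length + k).choose k := by
  induction l₀ generalizing k with
  | nil => simp [insertOnes_nil]
  | cons x l₀ ih =>
    have hx : x ≠ 1 := fun e => h (by simp [e])
    induction k with
    | zero => simp [insertOnes_zero h]
    | succ k ihk =>
      obtain ⟨hf, hc⟩ := ih (fun e => h (List.mem_cons_of_mem _ e)) (k + 1)
      rw [insertOnes_cons_succ hx]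
      refine ⟨(ihk.1.image _).union (hf.image _), ?_⟩
      rw [Set.ncard_union_eq _ (ihk.1.image _) (hf.image _),
        List.cons_injective.injOn.ncard_image, List.cons_injective.injOn.ncard_image, ihk.2, hc,
        List.length_cons, ← add_assoc (l₀.length + 1), Nat.choose_succ_succ,
        add_right_comm l₀.length 1 k, ← add_assoc l₀.length]
      · rw [Set.disjoint_left]
        rintro _ ⟨l, -, rfl⟩ ⟨m, -, h⟩
        exact hx (List.cons.inj h).1

theorem length_filter_add_count (l : List ℕ) :
    (l.filter (· ≠ 1)).length + l.count 1 = l.length := by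
  induction l with
  | nil => rfl
  | cons x l ih => by_cases hx : x = 1 <;> simp_all <;> omega

theorem sum_filter_add_count (l : List ℕ) : (l.filter (· ≠ 1)).sum + l.count 1 = l.sum := by
  induction l with
  | nil => rfl
  | cons x l ih => by_cases hx : x = 1 <;> simp_all <;> omega

/-- Entries `1` do not change the difference between length and sum of a suffix, so they play no
role in the ballot condition. -/
theorem ballot_filter (l : List ℕ) : Ballot (l.filter (· ≠ 1)) ↔ Ballot l := by
  induction l with
  | nil => rfl
  | cons x l ih =>
    have h1 := length_filter_add_count l
    have h2 := sum_filter_add_count l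
    by_cases hx : x = 1
    · subst hx
      rw [List.filter_cons_of_neg (by simp), ih, Ballot]
      refine (and_iff_right_of_imp fun h => ?_).symm
      have := h.sum_le_length
      omega
    · rw [List.filter_cons_of_pos (by simpa using hx), Ballot, Ballot, ih]
      refine and_congr_left fun _ => ?_
      omega

theorem finite_codes (n : ℕ) : (codes n).Finite := by
  rw [← (bijOn_codePath n).image_eq]
  have : Finite {p : DyckWord // p.semilength = n} := inferInstance
  exact (Set.finite_coe_iff.1 this).image _

/-- A code with `k` entries `1` arises from a code without entries `1` by inserting `k` of them at
arbitrary places. -/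
theorem ncard_codes_count_one {n k : ℕ} (hk : k ≤ n) :
    {l ∈ codes n | l.count 1 = k}.ncard
      = n.choose k * {l ∈ codes (n - k) | l.count 1 = 0}.ncard := by
  have hcodes : ∀ l : List ℕ, l.count 1 = k →
      (l.filter (· ≠ 1) ∈ codes (n - k) ↔ l ∈ codes n) := by
    intro l hl
    have h1 := length_filter_add_count l
    have h2 := sum_filter_add_count l
    simp only [codes, Set.mem_ofPred_eq, ballot_filter]
    exact ⟨fun ⟨h, hb, h'⟩ => ⟨by omega, hb, by omega⟩, fun ⟨h, hb, h'⟩ => ⟨by omega, hb, by omega⟩⟩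
  refine Set.ncard_eq_mul_of_fibers (f := List.filter (· ≠ 1))
    ((finite_codes n).subset fun l hl => hl.1)
    ((finite_codes (n - k)).subset fun l hl => hl.1) ?_ ?_
  · rintro l ⟨hl, hc⟩
    exact ⟨(hcodes l hc).2 hl, List.count_eq_zero.2 (by simp)⟩
  · rintro l₀ ⟨hl₀, hc₀⟩
    have : {l | l ∈ {l ∈ codes n | l.count 1 = k} ∧ l.filter (· ≠ 1) = l₀} = insertOnes l₀ k := by
      ext l
      constructor
      · rintro ⟨⟨-, hc⟩, h⟩
        exact ⟨h, hc⟩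
      · rintro ⟨rfl, hc⟩
        exact ⟨⟨(hcodes l hc).1 hl₀, hc⟩, rfl⟩
    rw [this, (finite_insertOnes_and_ncard l₀ (List.count_eq_zero.1 hc₀) k).2, hl₀.1,
      Nat.sub_add_cancel hk]

theorem sum_choose_mul_ncard_codes (n : ℕ) :
    ∑ k ∈ Finset.range (n + 1), n.choose k * {l ∈ codes k | l.count 1 = 0}.ncard
      = catalan n := by
  rw [← ncard_codes, Set.ncard_eq_sum_range (finite_codes n) (f := List.count 1) (n := n)
    fun l hl => List.count_le_length.trans_eq hl.1]
  rw [← Finset.sum_flip]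
  refine Finset.sum_congr rfl fun k hk => ?_
  have hk : k ≤ n := Nat.lt_succ_iff.1 (Finset.mem_range.1 hk)
  rw [ncard_codes_count_one hk, Nat.choose_symm hk]

end BallotCode

namespace FlattenedPartition

open fwdDiff in
/-- The Riordan numbers are the iterated differences of the Catalan numbers at `0`, so this is the
Gregory-Newton formula. -/
theorem sum_choose_mul_riordan (n : ℕ) :
    ∑ k ∈ Finset.range (n + 1), (n.choose k : ℤ) * riordan k = catalan n := by
  have h := shift_eq_sum_fwdDiff_iter (1 : ℕ) (fun m => (catalan m : ℤ)) n 0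
  simp only [smul_eq_mul, mul_one, zero_add, nsmul_eq_mul] at h
  rw [h]
  refine Finset.sum_congr rfl fun k _ => ?_
  rw [fwdDiff_iter_eq_sum_shift, riordan]
  simp

/-- Binomial inversion: the codes without entries `1` are counted by the Riordan numbers. -/
theorem ncard_codes_no_one (n : ℕ) :
    ({l ∈ BallotCode.codes n | l.count 1 = 0}.ncard : ℤ) = riordan n := by
  induction n using Nat.strong_induction_on with
  | _ n ih =>
    have h := sum_choose_mul_riordan n
    rw [← BallotCode.sum_choose_mul_ncard_codes, Finset.sum_range_succ, Finset.sum_range_succ,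
      Nat.cast_add, Nat.cast_sum] at h
    rw [Finset.sum_congr rfl fun k hk => by
      rw [← ih k (Finset.mem_range.1 hk), ← Nat.cast_mul]] at h
    simpa using h.symm

theorem sum_choose_mul_choose {n j : ℕ} (hj : j ≤ n) :
    ∑ k ∈ Finset.range (n + 1), n.choose k * k.choose j = n.choose j * 2 ^ (n - j) := by
  obtain ⟨m, rfl⟩ := Nat.exists_eq_add_of_le hj
  rw [add_assoc, Finset.sum_range_add, Finset.sum_eq_zero fun k hk => by
    rw [Nat.choose_eq_zero_of_lt (Finset.mem_range.1 hk), mul_zero], zero_add,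
    Nat.add_sub_cancel_left, ← Nat.sum_range_choose, Finset.mul_sum]
  refine Finset.sum_congr rfl fun k hk => ?_
  rw [Nat.choose_mul (Nat.le_add_right j k), Nat.add_sub_cancel_left, Nat.add_sub_cancel_left]

theorem sum_choose_mul_two_pow_mul_riordan (n : ℕ) :
    ∑ k ∈ Finset.range (n + 1), (n.choose k : ℤ) * 2 ^ k * riordan (n - k)
      = ∑ k ∈ Finset.range (n + 1), (n.choose k : ℤ) * (catalan k : ℤ) := by
  calc
    _ = ∑ j ∈ Finset.range (n + 1), (n.choose j : ℤ) * 2 ^ (n - j) * riordan j := by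
      rw [← Finset.sum_flip]
      refine Finset.sum_congr rfl fun k hk => ?_
      have hk : k ≤ n := Nat.lt_succ_iff.1 (Finset.mem_range.1 hk)
      rw [Nat.choose_symm hk, Nat.sub_sub_self hk]
    _ = ∑ j ∈ Finset.range (n + 1), ∑ k ∈ Finset.range (n + 1),
          (n.choose k : ℤ) * (k.choose j * riordan j) := by
      refine Finset.sum_congr rfl fun j hj => ?_
      have := sum_choose_mul_choose (Nat.lt_succ_iff.1 (Finset.mem_range.1 hj))
      simp only [← mul_assoc, ← Finset.sum_mul]
      exact_mod_cast congrArg (fun m : ℕ => (m : ℤ) * riordan j) this.symm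
    _ = _ := by
      rw [Finset.sum_comm]
      refine Finset.sum_congr rfl fun k hk => ?_
      rw [← Finset.mul_sum, ← sum_choose_mul_riordan]
      congr 1
      -- The terms with `j > k` vanish
      refine (Finset.sum_subset (Finset.range_mono (Finset.mem_range.1 hk)) fun j _ hj => ?_).symm
      rw [Nat.choose_eq_zero_of_lt (by simpa [Nat.lt_succ_iff] using hj), Nat.cast_zero, zero_mul]

end FlattenedPartition

/-! ### Ballot codes and 321-avoiding words -/

namespace BallotCode

/-- The word has no decreasing subsequence of length three. -/
abbrev Avoids321 (w : List ℕ) : Prop :=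
  w.Triplewise fun a b c => ¬ (c < b ∧ b < a)

/-- Inserting a new smallest letter preserves 321-avoidance exactly when the letters before it are
increasing. -/
theorem avoids321_insert {v : ℕ} {s t : List ℕ} (h : ∀ a ∈ s ++ t, v < a) :
    Avoids321 (s ++ v :: t) ↔ Avoids321 (s ++ t) ∧ s.Pairwise (· ≤ ·) := by
  have ht : t.Pairwise fun b c => ¬ (c < b ∧ b < v) :=
    List.pairwise_of_forall_mem_list fun b hb c _ => by have := h b (by simp [hb]); omega
  have hs : ∀ a ∈ s, ∀ c ∈ t, ¬ (c < v ∧ v < a) := fun a _ c hc => by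
    have := h c (by simp [hc]); omega
  have hsv : (s.Pairwise fun a b => ¬ (v < b ∧ b < a)) ↔ s.Pairwise (· ≤ ·) :=
    List.Pairwise.iff_of_mem fun {a b} _ hb => by
      have := h b (by simp [hb]); omega
  simp only [Avoids321, List.triplewise_append, List.triplewise_cons, List.pairwise_cons,
    List.mem_cons, forall_eq_or_imp]
  rw [hsv]
  constructor
  · rintro ⟨h1, ⟨-, h2⟩, h3, h4, h5⟩
    exact ⟨⟨h1, h2, fun a ha => (h3 a ha).2, h5⟩, h4⟩
  · rintro ⟨⟨h1, h2, h3, h5⟩, h4⟩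
    exact ⟨h1, ⟨ht, h2⟩, fun a ha => ⟨hs a ha, h3 a ha⟩, h4, h5⟩

/-- The 321-avoiding arrangements of the letters `v, …, v + m - 1` that start with `d` increasing
letters. -/
def words (v m d : ℕ) : Set (List ℕ) :=
  {w | w.Perm (List.range' v m) ∧ Avoids321 w ∧ d ≤ m ∧ (w.take d).Pairwise (· ≤ ·)}

theorem lt_of_perm_range' {v m : ℕ} {w : List ℕ} (h : w.Perm (List.range' (v + 1) m)) :
    ∀ a ∈ w, v < a := fun a ha => by
  have := List.mem_range'_1.1 (h.mem_iff.1 ha)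
  omega

theorem perm_range'_succ_iff {v m : ℕ} {s t : List ℕ} :
    (s ++ v :: t).Perm (List.range' v (m + 1)) ↔ (s ++ t).Perm (List.range' (v + 1) m) := by
  rw [List.range'_succ]
  exact ⟨fun h => (List.perm_middle.symm.trans h).cons_inv,
    fun h => List.perm_middle.trans (h.cons v)⟩

theorem insert_mem_words_iff {v m d : ℕ} {s t : List ℕ} (hd : d ≤ s.length) :
    s ++ v :: t ∈ words v (m + 1) d ↔ s ++ t ∈ words (v + 1) m s.length := by
  simp only [words, Set.mem_ofPred_eq, perm_range'_succ_iff]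
  refine and_congr_right fun h => ?_
  have hlen := h.length_eq
  simp only [List.length_append, List.length_range'] at hlen
  rw [avoids321_insert (lt_of_perm_range' h), List.take_append_of_le_length hd, List.take_left]
  constructor
  · rintro ⟨⟨h1, h2⟩, -, -⟩
    exact ⟨h1, by omega, h2⟩
  · rintro ⟨h1, -, h2⟩
    exact ⟨⟨h1, h2⟩, by omega, h2.sublist (List.take_sublist _ _)⟩

theorem cons_mem_words_iff {v m d : ℕ} {t : List ℕ} :
    v :: t ∈ words v (m + 1) (d + 1) ↔ t ∈ words (v + 1) m d := by
  simp only [words, Set.mem_ofPred_eq]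
  rw [← List.nil_append (v :: t), perm_range'_succ_iff, List.nil_append]
  refine and_congr_right fun h => ?_
  have hv := lt_of_perm_range' h
  rw [avoids321_insert (by simpa using hv)]
  simp only [List.nil_append, List.Pairwise.nil, and_true, List.take_succ_cons,
    List.pairwise_cons, Nat.add_le_add_iff_right]
  refine and_congr_right fun _ => and_congr_right fun _ => and_iff_right fun a ha => ?_
  exact (hv a (List.mem_of_mem_take ha)).le

/-- The word with letters `v, v + 1, …` of a code: an entry `0` puts the smallest letter in front,
while an entry `x > 0` inserts it at the index given by the excess of length over sum of the
remaining code. -/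
def decode : ℕ → List ℕ → List ℕ
  | _, [] => []
  | v, 0 :: l => v :: decode (v + 1) l
  | v, (_ + 1) :: l =>
    (decode (v + 1) l).take (l.length - l.sum) ++ v :: (decode (v + 1) l).drop (l.length - l.sum)

theorem length_decode (v : ℕ) (l : List ℕ) : (decode v l).length = l.length := by
  induction l generalizing v with
  | nil => rfl
  | cons x l ih =>
    cases x with
    | zero => simp [decode, ih]
    | succ x =>
      simp only [decode, List.length_append, List.length_cons, List.length_take, List.length_drop,
        ih]
      omega

theorem mapsTo_decode (v m d : ℕ) :
    Set.MapsTo (decode v) {l | l.length = m ∧ Ballot l ∧ l.sum + d = m} (words v m d) := by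
  rintro l ⟨rfl, hb, hd⟩
  induction l generalizing v d with
  | nil =>
    obtain rfl : d = 0 := by simpa using hd
    simp [words, decode]
  | cons x l ih =>
    have hs := hb.2.sum_le_length
    simp only [List.sum_cons, List.length_cons] at hd
    cases x with
    | zero =>
      obtain ⟨d, rfl⟩ := Nat.exists_eq_succ_of_ne_zero (n := d) (by omega)
      exact cons_mem_words_iff.2 (ih (v + 1) d hb.2 (by omega))
    | succ x =>
      have hlen : ((decode (v + 1) l).take (l.length - l.sum)).length = l.length - l.sum := by
        rw [List.length_take, length_decode]
        omega
      refine (insert_mem_words_iff (by rw [hlen]; omega)).2 ?_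
      rw [List.take_append_drop, hlen]
      exact ih (v + 1) _ hb.2 (by omega)

theorem append_cons_inj_of_notMem_left {α : Type*} {a : α} {s s' t t' : List α} (hs : a ∉ s)
    (hs' : a ∉ s') (h : s ++ a :: t = s' ++ a :: t') : s = s' ∧ t = t' := by
  induction s generalizing s' with
  | nil =>
    cases s' with
    | nil => simpa using h
    | cons b s' => exact absurd (List.mem_cons.2 (.inl (List.cons.inj h).1)) hs'
  | cons b s ih =>
    cases s' with
    | nil => exact absurd (List.mem_cons.2 (.inl (List.cons.inj h).1.symm)) hs
    | cons c s' =>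
      simp only [List.cons_append, List.cons.injEq, List.mem_cons, not_or] at h hs hs'
      obtain ⟨rfl, rfl⟩ := ih hs.2 hs'.2 h.2
      exact ⟨by rw [h.1], rfl⟩

/-- Removing the smallest letter of a word recovers its code entry by entry: that letter is either
the first of the `d` increasing letters, or behind all of them. -/
theorem bijOn_decode (v m d : ℕ) :
    Set.BijOn (decode v) {l | l.length = m ∧ Ballot l ∧ l.sum + d = m} (words v m d) := by
  induction m generalizing v d with
  | zero =>
    refine ⟨mapsTo_decode v 0 d, fun l hl l' hl' _ => ?_, fun w hw => ?_⟩
    · rw [List.length_eq_zero_iff.1 hl.1, List.length_eq_zero_iff.1 hl'.1]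
    · refine ⟨[], ⟨rfl, trivial, ?_⟩, ?_⟩
      · simpa using hw.2.2.1
      · exact (List.perm_nil.1 hw.1).symm
  | succ m ih =>
    have hlt : ∀ {d l}, l ∈ {l | l.length = m ∧ Ballot l ∧ l.sum + d = m} →
        v ∉ decode (v + 1) l := fun hl h =>
      (lt_of_perm_range' ((mapsTo_decode (v + 1) m _) hl).1 v h).false
    refine ⟨mapsTo_decode v (m + 1) d, ?_, fun w hw => ?_⟩
    · rintro (- | ⟨x, l⟩) ⟨hl, hb, hd⟩ (- | ⟨y, k⟩) ⟨hk, hc, he⟩ h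
      any_goals simp at hl hk
      simp only [List.sum_cons] at hd he
      have hl' : l ∈ {l' : List ℕ | l'.length = m ∧ Ballot l' ∧ l'.sum + (l.length - l.sum) = m} :=
        ⟨hl, hb.2, by have := hb.2.sum_le_length; omega⟩
      have hk' : k ∈ {l' : List ℕ | l'.length = m ∧ Ballot l' ∧ l'.sum + (k.length - k.sum) = m} :=
        ⟨hk, hc.2, by have := hc.2.sum_le_length; omega⟩
      have hlv := hlt hl'
      have hkv := hlt hk'
      have hln := length_decode (v + 1) l
      have hkn := length_decode (v + 1) k
      have hlsum := hb.2.sum_le_length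
      have hksum := hc.2.sum_le_length
      have hsplit : ∀ n w, v ∉ w → v ∉ List.take n w := fun n w h h' => h (List.mem_of_mem_take h')
      -- The index of `v` determines whether the first entry vanishes, and its value otherwise
      rcases x with - | x <;> rcases y with - | y
      · simp only [decode, List.cons.injEq, true_and] at h
        rw [(ih (v + 1) _).injOn hl' ⟨hk, hc.2, by omega⟩ h]
      · have := append_cons_inj_of_notMem_left (s := []) (by simp) (hsplit _ _ hkv) h
        have := congrArg List.length this.1
        simp only [List.length_nil, List.length_take] at this
        omega
      · have := append_cons_inj_of_notMem_left (s' := []) (hsplit _ _ hlv) (by simp) h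
        have := congrArg List.length this.1
        simp only [List.length_nil, List.length_take] at this
        omega
      · obtain ⟨h1, h2⟩ := append_cons_inj_of_notMem_left (hsplit _ _ hlv) (hsplit _ _ hkv) h
        have hlen := congrArg List.length h1
        simp only [List.length_take] at hlen
        have h3 := congrArg₂ (· ++ ·) h1 h2
        simp only [List.take_append_drop] at h3
        obtain rfl := (ih (v + 1) _).injOn hl' ⟨hk, hc.2, by omega⟩ h3
        congr 1
        omega
    · have hv : v ∈ w := hw.1.mem_iff.2 (by simp)
      obtain ⟨s, t, rfl, -⟩ := List.eq_append_cons_of_mem hv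
      by_cases hds : d ≤ s.length
      · have hst := (insert_mem_words_iff hds).1 hw
        obtain ⟨l, ⟨hl, hb, hsum⟩, hdec⟩ := (ih (v + 1) s.length).surjOn hst
        refine ⟨(s.length - d + 1) :: l, ⟨by simp [hl], ⟨by omega, hb⟩, ?_⟩, ?_⟩
        · rw [List.sum_cons]
          omega
        · have : l.length - l.sum = s.length := by omega
          rw [decode, hdec, this, List.take_left, List.drop_left]
      · -- A letter before the smallest one among the first `d` letters would create a descent
        have hs : s = [] := by
          by_contra hs
          obtain ⟨a, s, rfl⟩ := List.exists_cons_of_ne_nil hs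
          have ha := lt_of_perm_range' (perm_range'_succ_iff.1 hw.1) a (by simp)
          obtain ⟨d, rfl⟩ := Nat.exists_eq_succ_of_ne_zero (n := d) (by rintro rfl; simp at hds)
          have hp := hw.2.2.2
          rw [List.cons_append, List.take_succ_cons, List.pairwise_cons] at hp
          have hvd : v ∈ (s ++ v :: t).take d := by
            rw [List.take_append, List.mem_append]
            right
            obtain ⟨j, hj⟩ := Nat.exists_eq_succ_of_ne_zero (n := d - s.length)
              (by simp at hds; omega)
            rw [hj, List.take_succ_cons]
            exact List.mem_cons_self
          exact absurd (hp.1 v hvd) (by omega)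
        subst hs
        obtain ⟨d, rfl⟩ := Nat.exists_eq_succ_of_ne_zero (n := d) (by rintro rfl; simp at hds)
        obtain ⟨l, ⟨hl, hb, hsum⟩, hdec⟩ := (ih (v + 1) d).surjOn (cons_mem_words_iff.1 hw)
        refine ⟨0 :: l, ⟨by simp [hl], ⟨by omega, hb⟩, ?_⟩, ?_⟩
        · rw [List.sum_cons]
          omega
        · rw [decode, hdec, List.nil_append]

/-- The right-to-left minima of a word that exceed their predecessor, where `p` counts as the
predecessor of the first letter. -/
def minima : ℕ → List ℕ → List ℕ
  | _, [] => []
  | p, a :: w => if p < a ∧ ∀ b ∈ w, a < b then a :: minima a w else minima a w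

theorem minima_congr {p q : ℕ} {w : List ℕ} (h : ∀ a ∈ w, p < a ∧ q < a) :
    minima p w = minima q w := by
  cases w with
  | nil => rfl
  | cons a w => simp [minima, h a]

theorem minima_insert {v : ℕ} {s t : List ℕ} (h : ∀ a ∈ s ++ t, v < a) (hs : s ≠ []) (p : ℕ) :
    minima p (s ++ v :: t) = minima v t := by
  induction s generalizing p with
  | nil => exact absurd rfl hs
  | cons a s ih =>
    have ha : v < a := h a (by simp)
    have h1 : ¬ (p < a ∧ ∀ b ∈ s ++ v :: t, a < b) := fun h' => by
      have := h'.2 v (by simp)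
      omega
    rw [List.cons_append, minima, if_neg h1]
    rcases eq_or_ne s [] with rfl | hs
    · rw [List.nil_append, minima, if_neg (by omega)]
    · exact ih (fun b hb => h b (by simp at hb ⊢; tauto)) hs a

/-- After the first `d` letters of a word are dropped, the entries `1` of its code count the
right-to-left minima which are not descent terminators. The predecessor `0` makes the first
remaining letter count as an ascent: either it is never preceded by a letter, or the first smaller
letter that is not put in front of the whole word is inserted directly before it. -/
theorem length_minima_decode (v m d : ℕ) (l : List ℕ) (hv : 0 < v)
    (hl : l ∈ {l : List ℕ | l.length = m ∧ Ballot l ∧ l.sum + d = m}) :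
    (minima 0 ((decode v l).drop d)).length = l.count 1 := by
  obtain ⟨rfl, hb, hd⟩ := hl
  induction l generalizing v d with
  | nil => simp [decode, minima]
  | cons x l ih =>
    have hs := hb.2.sum_le_length
    simp only [List.sum_cons, List.length_cons] at hd
    have hw := mapsTo_decode (v + 1) l.length (l.length - l.sum)
      (show l ∈ _ from ⟨rfl, hb.2, by omega⟩)
    have hlt := lt_of_perm_range' hw.1
    have ih' := fun d => ih (v + 1) d (by omega) hb.2
    have hlen := length_decode (v + 1) l
    cases x with
    | zero =>
      obtain ⟨d, rfl⟩ := Nat.exists_eq_succ_of_ne_zero (n := d) (by omega)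
      simpa [decode] using ih' d (by omega)
    | succ x =>
      have htl : ((decode (v + 1) l).take (l.length - l.sum)).length = l.length - l.sum := by
        rw [List.length_take]
        omega
      rw [decode, List.drop_append_of_le_length (by omega)]
      have h0 : minima v ((decode (v + 1) l).drop (l.length - l.sum))
          = minima 0 ((decode (v + 1) l).drop (l.length - l.sum)) :=
        minima_congr fun a ha => by
          have := hlt a (List.mem_of_mem_drop ha)
          omega
      have hrec := ih' (l.length - l.sum) (by omega)
      rcases Nat.eq_zero_or_pos x with rfl | hx
      · rw [List.drop_of_length_le (by omega), List.nil_append, minima, if_pos,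
          List.length_cons, h0, hrec]
        · simp
        · exact ⟨hv, fun b hb => hlt b (List.mem_of_mem_drop hb)⟩
      · rw [minima_insert, h0, hrec, List.count_cons_of_ne (by omega)]
        · intro a ha
          refine hlt a ?_
          rcases List.mem_append.1 ha with h | h
          · exact List.mem_of_mem_take (List.mem_of_mem_drop h)
          · exact List.mem_of_mem_drop h
        · rw [← List.length_pos_iff_ne_nil, List.length_drop, htl]
          omega

/-- The 321-avoiding permutations of `n` consecutive positive letters with `k` right-to-left minima
which are not smaller than their predecessor correspond to the codes with `k` entries `1`. -/
theorem ncard_words (v n k : ℕ) (hv : 0 < v) :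
    {w ∈ words v n 0 | (minima 0 w).length = k}.ncard = {l ∈ codes n | l.count 1 = k}.ncard := by
  have h := bijOn_decode v n 0
  have hmin : ∀ l ∈ codes n, (minima 0 (decode v l)).length = l.count 1 := fun l hl => by
    simpa using length_minima_decode v n 0 l hv (by simpa [codes] using hl)
  have key : Set.BijOn (decode v) {l ∈ codes n | l.count 1 = k}
      {w ∈ words v n 0 | (minima 0 w).length = k} := by
    refine ⟨fun l hl => ⟨h.mapsTo hl.1, (hmin l hl.1).trans hl.2⟩,
      h.injOn.mono fun l hl => hl.1, ?_⟩
    rintro w ⟨hw, hk⟩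
    obtain ⟨l, hl, rfl⟩ := h.surjOn hw
    exact ⟨l, ⟨hl, (hmin l hl).symm.trans hk⟩, rfl⟩
  rw [← key.image_eq, key.injOn.ncard_image]

end BallotCode

/-! ### The standard increasing form of a partition -/

namespace FlattenedPartition

open BallotCode

/-- A list of blocks is cut by `I` when exactly the first entry of each block lies in `I`. -/
def CutBy (I : Finset ℕ) (L : List (List ℕ)) : Prop :=
  ∀ b ∈ L, ∃ a t, b = a :: t ∧ a ∈ I ∧ ∀ x ∈ t, x ∉ I

/-- A list of blocks is in standard increasing form when every block is increasing and its first
entry is smaller than all entries of the later blocks. -/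
def Standard : List (List ℕ) → Prop
  | [] => True
  | b :: L => b.Pairwise (· < ·) ∧ (∀ a ∈ b.head?, ∀ x ∈ L.flatten, a < x) ∧ Standard L

theorem CutBy.tail {I : Finset ℕ} {b : List ℕ} {L : List (List ℕ)} (h : CutBy I (b :: L)) :
    CutBy I L :=
  fun c hc => h c (List.mem_cons_of_mem _ hc)

theorem CutBy.head_mem {I : Finset ℕ} {L : List (List ℕ)} (h : CutBy I L) {a : ℕ} {w : List ℕ}
    (hw : L.flatten = a :: w) : a ∈ I := by
  cases L with
  | nil => simp at hw
  | cons b L =>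
    obtain ⟨c, t, rfl, hc, -⟩ := h b (by simp)
    simp only [List.flatten_cons, List.cons_append, List.cons.injEq] at hw
    exact hw.1 ▸ hc

/-- Splitting a word before each letter of `I` can be done in one way only. -/
theorem CutBy.eq_of_flatten_eq {I : Finset ℕ} {L L' : List (List ℕ)} (h : CutBy I L)
    (h' : CutBy I L') (he : L.flatten = L'.flatten) : L = L' := by
  induction L generalizing L' with
  | nil =>
    cases L' with
    | nil => rfl
    | cons b L' =>
      obtain ⟨a, t, rfl, -⟩ := h' b (by simp)
      simp at he
  | cons b L ih =>
    cases L' with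
    | nil =>
      obtain ⟨a, t, rfl, -⟩ := h b (by simp)
      simp at he
    | cons b' L' =>
      obtain ⟨a, t, rfl, -, ht⟩ := h b (by simp)
      obtain ⟨a', t', rfl, -, ht'⟩ := h' b' (by simp)
      simp only [List.flatten_cons, List.cons_append, List.cons.injEq] at he
      obtain ⟨rfl, he⟩ := he
      rcases List.append_eq_append_iff.1 he with ⟨r, hr, hr'⟩ | ⟨r, hr, hr'⟩
      · cases r with
        | nil =>
          rw [List.append_nil] at hr
          rw [hr, ih h.tail h'.tail hr']
        | cons x r => exact absurd (h.tail.head_mem hr') (ht' x (by simp [hr]))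
      · cases r with
        | nil =>
          rw [List.append_nil] at hr
          rw [hr, ih h.tail h'.tail hr'.symm]
        | cons x r => exact absurd (h'.tail.head_mem hr') (ht x (by simp [hr]))

theorem exists_cutBy (I : Finset ℕ) (w : List ℕ) :
    ∃ t L, w = t ++ List.flatten L ∧ (∀ x ∈ t, x ∉ I) ∧ CutBy I L := by
  induction w with
  | nil => exact ⟨[], [], rfl, by simp, by simp [CutBy]⟩
  | cons a w ih =>
    obtain ⟨t, L, rfl, ht, hL⟩ := ih
    by_cases ha : a ∈ I
    · refine ⟨[], (a :: t) :: L, by simp, by simp, fun b hb => ?_⟩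
      rcases List.mem_cons.1 hb with rfl | hb
      · exact ⟨a, t, rfl, ha, ht⟩
      · exact hL b hb
    · exact ⟨a :: t, L, by simp, by simpa [ha] using ht, hL⟩

/-- In standard form, the block initiators are right-to-left minima. -/
theorem Standard.lt_of_mem {I : Finset ℕ} {L : List (List ℕ)} (hs : Standard L) (hc : CutBy I L)
    {u v : List ℕ} {x : ℕ} (h : L.flatten = u ++ x :: v) (hx : x ∈ I) : ∀ b ∈ v, x < b := by
  induction L generalizing u with
  | nil => simp at h
  | cons b L ih =>
    obtain ⟨a, t, rfl, -, ht⟩ := hc b (by simp)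
    rw [List.flatten_cons] at h
    rcases List.append_eq_append_iff.1 h with ⟨r, rfl, hr⟩ | ⟨r, hr, hr'⟩
    · exact ih hs.2.2 hc.tail hr
    · rcases u with - | ⟨c, u⟩
      · rcases r with - | ⟨c, r⟩
        · simp at hr
        · simp only [List.nil_append, List.cons.injEq, List.cons_append] at hr hr'
          obtain ⟨rfl, rfl⟩ := hr'
          obtain ⟨rfl, rfl⟩ := hr
          intro b hb
          rcases List.mem_append.1 hb with hb | hb
          · exact (List.pairwise_cons.1 hs.1).1 b hb
          · exact hs.2.1 _ (by simp) b hb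
      · rcases r with - | ⟨d, r⟩
        · exact ih (u := []) hs.2.2 hc.tail hr'.symm
        · simp only [List.cons.injEq, List.cons_append] at hr hr'
          exact absurd hx (ht x (by simp [hr, hr'.1]))

/-- In standard form, an entry that is not a block initiator exceeds its predecessor. -/
theorem Standard.exists_getLast_lt {I : Finset ℕ} {L : List (List ℕ)} (hs : Standard L)
    (hc : CutBy I L) {u v : List ℕ} {x : ℕ} (h : L.flatten = u ++ x :: v) (hx : x ∉ I) :
    ∃ b, u.getLast? = some b ∧ b < x := by
  induction L generalizing u with
  | nil => simp at h
  | cons b L ih =>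
    obtain ⟨a, t, rfl, ha, ht⟩ := hc b (by simp)
    rw [List.flatten_cons] at h
    rcases List.append_eq_append_iff.1 h with ⟨r, rfl, hr⟩ | ⟨r, hr, hr'⟩
    · obtain ⟨b, hb, hbx⟩ := ih hs.2.2 hc.tail hr
      exact ⟨b, by rw [List.getLast?_append, hb]; rfl, hbx⟩
    · rcases r with - | ⟨d, r⟩
      · exact absurd (hc.tail.head_mem hr'.symm) hx
      · simp only [List.cons.injEq, List.cons_append] at hr'
        obtain ⟨rfl, -⟩ := hr'
        rcases List.eq_nil_or_concat u with rfl | ⟨u, b, rfl⟩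
        · simp only [List.nil_append, List.cons.injEq] at hr
          exact absurd (hr.1 ▸ ha) hx
        · have hp := hs.1
          rw [hr, List.pairwise_append] at hp
          exact ⟨b, by simp, hp.2.2 b (by simp) x (by simp)⟩

theorem standard_of_cutBy {I : Finset ℕ} {L : List (List ℕ)} (hc : CutBy I L)
    (hmin : ∀ u v x, L.flatten = u ++ x :: v → x ∈ I → ∀ b ∈ v, x < b)
    (hasc : ∀ u v x b, L.flatten = u ++ b :: x :: v → x ∉ I → b < x) : Standard L := by
  induction L with
  | nil => trivial
  | cons b L ih =>
    obtain ⟨a, t, rfl, ha, ht⟩ := hc b (by simp)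
    refine ⟨?_, ?_, ih hc.tail (fun u v x h => ?_) fun u v x b h => ?_⟩
    · refine List.isChain_iff_pairwise.1 (List.isChain_iff_forall_rel_of_append_cons_cons.2 ?_)
      intro b x l₁ l₂ h
      refine hasc l₁ (l₂ ++ L.flatten) x b (by simp [h]) (ht x ?_)
      cases l₁ with
      | nil =>
        simp only [List.nil_append, List.cons.injEq] at h
        simp [h.2]
      | cons c l₁ =>
        simp only [List.cons_append, List.cons.injEq] at h
        simp [h.2]
    · intro a' ha' x hx
      obtain rfl : a = a' := by simpa using ha'
      exact hmin [] _ a rfl ha x (List.mem_append.2 (.inr hx))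
    · exact hmin ((a :: t) ++ u) v x (by simp [h])
    · exact hasc ((a :: t) ++ u) v x b (by simp [h])

theorem exists_cons_of_forall_le {l : List ℕ} {a : ℕ} (hl : l.Pairwise (· < ·)) (ha : a ∈ l)
    (h : ∀ b ∈ l, a ≤ b) : ∃ t, l = a :: t := by
  cases l with
  | nil => simp at ha
  | cons b t =>
    rcases List.mem_cons.1 ha with rfl | ha
    · exact ⟨t, rfl⟩
    · exact absurd (h b (by simp)) (not_le.2 ((List.pairwise_cons.1 hl).1 a ha))

section Partition

variable {n : ℕ} (P : Finpartition (interval n))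

theorem mem_initiators {a : ℕ} : a ∈ initiators P ↔ a ∈ interval n ∧ ∀ b ∈ P.part a, a ≤ b := by
  rw [initiators, Finset.mem_filter]

theorem mem_standardForm {b : List ℕ} :
    b ∈ standardForm P ↔ ∃ a ∈ initiators P, (P.part a).sort (· ≤ ·) = b := by
  simp [standardForm]

theorem exists_initiator {p : Finset ℕ} (hp : p ∈ P.parts) :
    ∃ a ∈ initiators P, P.part a = p := by
  have hne := P.nonempty_of_mem_parts hp
  have hpart := P.part_eq_of_mem hp (p.min'_mem hne)
  refine ⟨p.min' hne, (mem_initiators P).2 ⟨P.le hp (p.min'_mem hne), fun b hb => ?_⟩, hpart⟩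
  rw [hpart] at hb
  exact p.min'_le b hb

theorem mem_parts_iff {p : Finset ℕ} :
    p ∈ P.parts ↔ ∃ b ∈ standardForm P, b.toFinset = p := by
  simp only [mem_standardForm]
  constructor
  · intro hp
    obtain ⟨a, ha, rfl⟩ := exists_initiator P hp
    exact ⟨_, ⟨a, ha, rfl⟩, Finset.sort_toFinset _ _⟩
  · rintro ⟨_, ⟨a, ha, rfl⟩, rfl⟩
    rw [Finset.sort_toFinset]
    exact P.part_mem.2 ((mem_initiators P).1 ha).1

theorem exists_sort_part_eq_cons {a : ℕ} (ha : a ∈ initiators P) :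
    ∃ t, (P.part a).sort (· ≤ ·) = a :: t := by
  rw [mem_initiators] at ha
  exact exists_cons_of_forall_le (P.part a).sortedLT_sort.pairwise
    ((Finset.mem_sort _).2 (P.mem_part ha.1)) fun b hb => ha.2 b ((Finset.mem_sort _).1 hb)

theorem cutBy_standardForm : CutBy (initiators P) (standardForm P) := by
  intro b hb
  obtain ⟨a, ha, rfl⟩ := (mem_standardForm P).1 hb
  have han := ((mem_initiators P).1 ha).1
  have hsort := (P.part a).sortedLT_sort.pairwise
  obtain ⟨t, ht⟩ := exists_sort_part_eq_cons P ha
  refine ⟨a, t, ht, ha, fun x hx hxi => ?_⟩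
  have hxa : x ∈ P.part a := by
    rw [← Finset.mem_sort (· ≤ ·), ht]
    exact List.mem_cons_of_mem _ hx
  rw [ht, List.pairwise_cons] at hsort
  have hpart := P.part_eq_of_mem (P.part_mem.2 han) hxa
  exact absurd (((mem_initiators P).1 hxi).2 a (hpart ▸ P.mem_part han)) (not_le.2 (hsort.1 x hx))

theorem mem_flatten {x : ℕ} : x ∈ flatten P ↔ x ∈ interval n := by
  simp only [flatten, List.mem_flatten, mem_standardForm]
  constructor
  · rintro ⟨_, ⟨a, ha, rfl⟩, hx⟩
    exact P.part_subset a (by simpa using hx)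
  · intro hx
    obtain ⟨a, ha, hp⟩ := exists_initiator P (P.part_mem.2 hx)
    exact ⟨_, ⟨a, ha, rfl⟩, by simpa [hp] using hx⟩

theorem eq_of_mem_part_of_mem_initiators {a b x : ℕ} (ha : a ∈ initiators P)
    (hb : b ∈ initiators P) (hxa : x ∈ P.part a) (hxb : x ∈ P.part b) : a = b := by
  rw [mem_initiators] at ha hb
  have h : P.part a = P.part b :=
    P.eq_of_mem_parts (P.part_mem.2 ha.1) (P.part_mem.2 hb.1) hxa hxb
  refine le_antisymm (ha.2 b ?_) (hb.2 a ?_)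
  · rw [h]; exact P.mem_part hb.1
  · rw [← h]; exact P.mem_part ha.1

theorem nodup_flatten : (flatten P).Nodup := by
  rw [flatten, List.nodup_flatten]
  refine ⟨fun b hb => ?_, ?_⟩
  · obtain ⟨a, -, rfl⟩ := (mem_standardForm P).1 hb
    exact Finset.sort_nodup _ _
  · rw [standardForm, List.pairwise_map]
    refine (initiators P).sortedLT_sort.pairwise.imp_of_mem fun {a b} ha hb hab => ?_
    rw [List.disjoint_left]
    intro x hxa hxb
    simp only [Finset.mem_sort] at ha hb hxa hxb
    exact hab.ne (eq_of_mem_part_of_mem_initiators P ha hb hxa hxb)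

theorem flatten_perm : (flatten P).Perm (List.range' 1 n) := by
  refine (List.perm_ext_iff_of_nodup (nodup_flatten P) List.nodup_range').2 fun x => ?_
  rw [mem_flatten, List.mem_range'_1, interval, Finset.mem_Icc]
  omega

theorem standard_map_sort {l : List ℕ} (hl : l.Pairwise (· < ·)) (hi : ∀ a ∈ l, a ∈ initiators P) :
    Standard (l.map fun a => (P.part a).sort (· ≤ ·)) := by
  induction l with
  | nil => trivial
  | cons a l ih =>
    rw [List.pairwise_cons] at hl
    refine ⟨(P.part a).sortedLT_sort.pairwise, fun a' ha' x hx => ?_,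
      ih hl.2 fun b hb => hi b (List.mem_cons_of_mem _ hb)⟩
    have ha := hi a (by simp)
    simp only [List.mem_flatten, List.mem_map, exists_exists_and_eq_and, Finset.mem_sort] at hx
    obtain ⟨b, hb, hx⟩ := hx
    have hab : a < x := (hl.1 b hb).trans_le
      (((mem_initiators P).1 (hi b (List.mem_cons_of_mem _ hb))).2 x hx)
    obtain ⟨t, ht⟩ := exists_sort_part_eq_cons P ha
    replace ha' : a' ∈ ((P.part a).sort (· ≤ ·)).head? := ha'
    rw [ht] at ha'
    obtain rfl : a = a' := by simpa using ha'
    exact hab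

theorem standard_standardForm : Standard (standardForm P) :=
  standard_map_sort P (initiators P).sortedLT_sort.pairwise (by simp)

/-- A partition is determined by its flattening together with its block initiators. -/
theorem eq_of_flatten_eq {P Q : Finpartition (interval n)} (h : flatten P = flatten Q)
    (hi : initiators P = initiators Q) : P = Q := by
  have hL : standardForm P = standardForm Q :=
    (cutBy_standardForm P).eq_of_flatten_eq (hi ▸ cutBy_standardForm Q) h
  ext p
  rw [mem_parts_iff, mem_parts_iff, hL]

/-- Every list of blocks in standard increasing form with entries `1, …, n` is the standard
increasing form of a partition. -/
theorem exists_standardForm_eq {I : Finset ℕ} {L : List (List ℕ)} (hc : CutBy I L)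
    (hs : Standard L) (hp : L.flatten.Perm (List.range' 1 n)) :
    ∃ P : Finpartition (interval n), standardForm P = L := by
  have hmem : ∀ x, x ∈ interval n ↔ ∃ b ∈ L, x ∈ b := fun x => by
    rw [← List.mem_flatten, hp.mem_iff, List.mem_range'_1, interval, Finset.mem_Icc]
    omega
  have hnd := List.nodup_flatten.1 (hp.nodup_iff.2 List.nodup_range')
  have huniq : ∀ b ∈ L, ∀ c ∈ L, ∀ x, x ∈ b → x ∈ c → b = c := fun b hb c hc x hxb hxc => by
    by_contra hne
    have : Std.Symm (List.Disjoint (α := ℕ)) := ⟨fun _ _ h => h.symm⟩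
    exact hnd.2.forall hb hc hne hxb hxc
  have hsorted : ∀ b ∈ L, b.Pairwise (· < ·) ∧ ∃ a t, b = a :: t := fun b hb => by
    refine ⟨?_, (hc b hb).imp fun a h => h.imp fun t h => h.1⟩
    clear hc hp hmem hnd huniq
    induction L with
    | nil => simp at hb
    | cons c L ih =>
      rcases List.mem_cons.1 hb with rfl | hb
      · exact hs.1
      · exact ih hs.2.2 hb
  let P : Finpartition (interval n) := Finpartition.ofExistsUnique (L.map List.toFinset).toFinset
    (by
      intro p hp' x hx
      obtain ⟨b, hb, rfl⟩ := by simpa using hp'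
      exact (hmem x).2 ⟨b, hb, by simpa using hx⟩)
    (by
      intro x hx
      obtain ⟨b, hb, hxb⟩ := (hmem x).1 hx
      refine ⟨b.toFinset, ⟨by simpa using ⟨b, hb, rfl⟩, by simpa using hxb⟩, ?_⟩
      rintro p ⟨hp', hx'⟩
      obtain ⟨c, hc', rfl⟩ := by simpa using hp'
      rw [huniq c hc' b hb x (by simpa using hx') hxb])
    (by
      intro h
      obtain ⟨b, hb, hb0⟩ := List.mem_map.1 (List.mem_toFinset.1 h)
      obtain ⟨-, a, t, rfl⟩ := hsorted b hb
      simp at hb0)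
  have hpart : ∀ b ∈ L, ∀ x ∈ b, P.part x = b.toFinset := fun b hb x hx =>
    P.part_eq_of_mem (List.mem_toFinset.2 (List.mem_map.2 ⟨b, hb, rfl⟩)) (List.mem_toFinset.2 hx)
  -- `List.headI` reads off the first entry of each block; all blocks are nonempty.
  have hheads : (L.map List.headI).Pairwise (· < ·) := by
    clear hp hmem hnd huniq P hpart
    induction L with
    | nil => simp
    | cons b L ih =>
      rw [List.map_cons, List.pairwise_cons]
      refine ⟨fun x hx => ?_, ih hc.tail hs.2.2 fun c hc' => hsorted c (List.mem_cons_of_mem _ hc')⟩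
      obtain ⟨c, hc', rfl⟩ := List.mem_map.1 hx
      obtain ⟨-, a, t, rfl⟩ := hsorted b (by simp)
      obtain ⟨-, a', t', rfl⟩ := hsorted c (List.mem_cons_of_mem _ hc')
      exact hs.2.1 a (by simp) a' (List.mem_flatten.2 ⟨_, hc', by simp⟩)
  have hinit : initiators P = (L.map List.headI).toFinset := by
    ext x
    rw [mem_initiators, List.mem_toFinset, List.mem_map, hmem]
    constructor
    · rintro ⟨⟨b, hb, hxb⟩, hmin⟩
      rw [hpart b hb x hxb] at hmin
      obtain ⟨t, rfl⟩ := exists_cons_of_forall_le (hsorted b hb).1 hxb (by simpa using hmin)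
      exact ⟨_, hb, rfl⟩
    · rintro ⟨b, hb, rfl⟩
      obtain ⟨hlt, a, t, rfl⟩ := hsorted b hb
      refine ⟨⟨_, hb, by simp⟩, ?_⟩
      rw [hpart _ hb _ (by simp)]
      intro y hy
      rcases List.mem_cons.1 (List.mem_toFinset.1 hy) with rfl | hy
      · exact le_rfl
      · exact ((List.pairwise_cons.1 hlt).1 y hy).le
  refine ⟨P, ?_⟩
  rw [standardForm, hinit, (List.toFinset_sort _ hheads.nodup).2 (hheads.imp le_of_lt),
    List.map_map]
  conv_rhs => rw [← List.map_id L]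
  refine List.map_congr_left fun b hb => ?_
  obtain ⟨hlt, a, t, rfl⟩ := hsorted b hb
  simp only [Function.comp_apply, id]
  rw [hpart _ hb _ (by simp), (List.toFinset_sort _ hlt.nodup).2 (hlt.imp le_of_lt)]

end Partition

end FlattenedPartition

/-! ### Partitions with a given flattening -/

namespace FlattenedPartition

open BallotCode

/-- The right-to-left minima of a word that are not descent terminators. -/
def freeMinima (w : List ℕ) : Set ℕ :=
  {a | IsRLMin w a ∧ ¬ IsDescentTerminator w a}

theorem IsRLMin.mem {w : List ℕ} {a : ℕ} (h : IsRLMin w a) : a ∈ w := by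
  obtain ⟨u, v, rfl, -⟩ := h
  simp

theorem IsDescentTerminator.mem {w : List ℕ} {a : ℕ} (h : IsDescentTerminator w a) : a ∈ w := by
  obtain ⟨u, v, rfl, -⟩ := h
  simp

theorem append_cons_inj_of_nodup {a : ℕ} {u v u' v' : List ℕ} (hn : (u ++ a :: v).Nodup)
    (h : u ++ a :: v = u' ++ a :: v') : u = u' ∧ v = v' := by
  have hn' := h ▸ hn
  rw [List.nodup_append] at hn hn'
  exact append_cons_inj_of_notMem_left (fun ha => hn.2.2 a ha a (by simp) rfl)
    (fun ha => hn'.2.2 a ha a (by simp) rfl) h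

theorem isRLMin_initiators {n : ℕ} (P : Finpartition (interval n)) {a : ℕ}
    (ha : a ∈ initiators P) : IsRLMin (flatten P) a := by
  obtain ⟨u, v, h, -⟩ :=
    List.eq_append_cons_of_mem ((mem_flatten P).2 ((mem_initiators P).1 ha).1)
  exact ⟨u, v, h, (standard_standardForm P).lt_of_mem (cutBy_standardForm P) h ha⟩

theorem mem_initiators_of_isDescentTerminator {n : ℕ} (P : Finpartition (interval n)) {a : ℕ}
    (ha : IsDescentTerminator (flatten P) a) : a ∈ initiators P := by
  by_contra hI
  obtain ⟨u, v, h, hu⟩ := ha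
  obtain ⟨b, hb, hba⟩ :=
    (standard_standardForm P).exists_getLast_lt (cutBy_standardForm P) h hI
  rcases hu with rfl | ⟨c, hc, hac⟩
  · simp at hb
  · rw [hb, Option.some.injEq] at hc
    omega

/-- Every set of right-to-left minima containing all descent terminators is the set of block
initiators of a partition with the given flattening. -/
theorem exists_flatten_eq_initiators_eq {n : ℕ} {w : List ℕ} (hw : w.Perm (List.range' 1 n))
    {I : Finset ℕ} (hD : ∀ a, IsDescentTerminator w a → a ∈ I) (hR : ∀ a ∈ I, IsRLMin w a) :
    ∃ P : Finpartition (interval n), flatten P = w ∧ initiators P = I := by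
  have hn : w.Nodup := hw.nodup_iff.2 List.nodup_range'
  obtain ⟨t, L, rfl, ht, hc⟩ := exists_cutBy I w
  have ht0 : t = [] := by
    cases t with
    | nil => rfl
    | cons a t => exact absurd (hD a ⟨[], t ++ L.flatten, rfl, .inl rfl⟩) (ht a (by simp))
  subst ht0
  rw [List.nil_append] at *
  have hs : Standard L := by
    refine standard_of_cutBy hc (fun u v x h hx => ?_) fun u v x b h hx => ?_
    · obtain ⟨u', v', h', hv'⟩ := hR x hx
      rw [h] at hn h'
      rwa [(append_cons_inj_of_nodup hn h').2]
    · have hne : b ≠ x := by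
        rintro rfl
        rw [h] at hn
        simp [List.nodup_append] at hn
      refine lt_of_le_of_ne (not_lt.1 fun hlt => hx (hD x ?_)) hne
      exact ⟨u ++ [b], v, by simp [h], .inr ⟨b, by simp, hlt⟩⟩
  obtain ⟨P, hP⟩ := exists_standardForm_eq hc hs hw
  have hPw : flatten P = L.flatten := congrArg List.flatten hP
  refine ⟨P, hPw, ?_⟩
  have hcP := hP ▸ cutBy_standardForm P
  -- A set that cuts `L` and contains only letters of `L` is the set of first entries of blocks.
  have hsub : ∀ I J : Finset ℕ, CutBy I L → CutBy J L → (∀ a ∈ I, a ∈ L.flatten) → I ⊆ J := by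
    intro I J hI hJ hmem x hx
    obtain ⟨b, hb, hxb⟩ := List.mem_flatten.1 (hmem x hx)
    obtain ⟨a, t, rfl, -, ht⟩ := hI b hb
    obtain ⟨a', t', h, ha', -⟩ := hJ _ hb
    rcases List.mem_cons.1 hxb with rfl | hxt
    · exact (List.cons.inj h).1 ▸ ha'
    · exact absurd hx (ht x hxt)
  exact (hsub _ _ hcP hc fun a ha => hPw ▸ (isRLMin_initiators P ha).mem).antisymm
    (hsub _ _ hc hcP fun a ha => (hR a ha).mem)

/-- The partitions with flattening `w` correspond to the choices of block initiators among the
right-to-left minima of `w`, where the descent terminators are forced. -/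
theorem ncard_flatten_eq {n : ℕ} {w : List ℕ} (hw : w.Perm (List.range' 1 n))
    (h : ∀ a, IsDescentTerminator w a → IsRLMin w a) :
    {P : Finpartition (interval n) | flatten P = w}.ncard = 2 ^ (freeMinima w).ncard := by
  classical
  let A := w.toFinset.filter (IsDescentTerminator w)
  let B := w.toFinset.filter (IsRLMin w)
  have hA : ∀ a, a ∈ A ↔ IsDescentTerminator w a := fun a => by
    simpa [A] using IsDescentTerminator.mem
  have hB : ∀ a, a ∈ B ↔ IsRLMin w a := fun a => by simpa [B] using IsRLMin.mem
  have hAB : A ⊆ B := fun a ha => (hB a).2 (h a ((hA a).1 ha))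
  have hM : freeMinima w = ↑(B \ A) := by
    ext a
    simp [freeMinima, hA, hB]
  have hinj : Set.InjOn (initiators (n := n)) {P | flatten P = w} := fun P hP Q hQ hi =>
    eq_of_flatten_eq (hP.trans hQ.symm) hi
  have himage : initiators '' {P : Finpartition (interval n) | flatten P = w}
      = ↑(Finset.Icc A B) := by
    ext I
    simp only [Set.mem_image, Set.mem_ofPred_eq, Finset.coe_Icc, Set.mem_Icc]
    constructor
    · rintro ⟨P, rfl, rfl⟩
      exact ⟨fun a ha => mem_initiators_of_isDescentTerminator P ((hA a).1 ha),
        fun a ha => (hB a).2 (isRLMin_initiators P ha)⟩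
    · rintro ⟨hAI, hIB⟩
      exact exists_flatten_eq_initiators_eq hw (fun a ha => hAI ((hA a).2 ha))
        fun a ha => (hB a).1 (hIB ha)
  rw [← hinj.ncard_image, himage, Set.ncard_coe_finset, Finset.card_Icc_finset hAB, hM,
    Set.ncard_coe_finset, Finset.card_sdiff_of_subset hAB]

theorem contains_321_iff (w : List ℕ) : Contains w [3, 2, 1] ↔ ¬ Avoids321 w := by
  rw [Avoids321, List.triplewise_iff_getElem]
  push Not
  constructor
  · rintro ⟨f, hf⟩
    have h0 := hf ⟨2, by simp⟩ ⟨1, by simp⟩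
    have h1 := hf ⟨1, by simp⟩ ⟨0, by simp⟩
    refine ⟨f ⟨0, by simp⟩, f ⟨1, by simp⟩, f ⟨2, by simp⟩, ?_, ?_, (f _).2, ?_, ?_⟩
    · exact f.lt_iff_lt.2 (by simp)
    · exact f.lt_iff_lt.2 (by simp)
    · exact h0.2 (by simp)
    · exact h1.2 (by simp)
  · rintro ⟨i, j, k, hij, hjk, hk, h1, h2⟩
    let g : Fin [3, 2, 1].length → Fin w.length := ![⟨i, by omega⟩, ⟨j, by omega⟩, ⟨k, hk⟩]
    have hg : StrictMono g := by
      intro a b hab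
      fin_cases a <;> fin_cases b <;> (simp_all [g]; try omega)
    refine ⟨OrderEmbedding.ofStrictMono g hg, fun a b => ?_⟩
    change w.get (g a) < w.get (g b) ↔ _
    fin_cases a <;> fin_cases b <;> simp [g] <;> omega

/-- In a 321-avoiding permutation starting with its minimum, descent terminators are right-to-left
minima. -/
theorem isRLMin_of_isDescentTerminator {w : List ℕ} {p : ℕ} (hn : (p :: w).Nodup)
    (hp : ∀ a ∈ w, p < a) (hw : Avoids321 (p :: w)) {a : ℕ} (ha : IsDescentTerminator (p :: w) a) :
    IsRLMin (p :: w) a := by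
  obtain ⟨u, v, h, hu⟩ := ha
  refine ⟨u, v, h, fun c hc => ?_⟩
  rcases List.eq_nil_or_concat u with rfl | ⟨u, b, rfl⟩
  · obtain ⟨rfl, rfl⟩ := List.cons.inj h
    exact hp c hc
  · have hab : a < b := by simpa using hu
    rw [h] at hn hw
    have hne : c ≠ a := by
      rintro rfl
      simp [List.nodup_append, hc] at hn
    simp only [List.concat_eq_append, List.append_assoc, List.singleton_append, Avoids321,
      List.triplewise_append, List.triplewise_cons, List.pairwise_cons] at hw
    have := hw.2.1.1.1 c hc
    omega

theorem mem_minima_iff {p : ℕ} {w : List ℕ} {a : ℕ} :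
    a ∈ minima p w ↔ ∃ u v, w = u ++ a :: v ∧ (∀ b ∈ v, a < b) ∧
      ∃ b, (p :: u).getLast? = some b ∧ b < a := by
  induction w generalizing p with
  | nil => simp [minima]
  | cons c w ih =>
    have hstep : a ∈ minima p (c :: w) ↔
        (a = c ∧ p < c ∧ ∀ b ∈ w, c < b) ∨ a ∈ minima c w := by
      rw [minima]
      split_ifs with h
      · rw [List.mem_cons]
        tauto
      · tauto
    rw [hstep, ih]
    constructor
    · rintro (⟨rfl, hp, hw⟩ | ⟨u, v, rfl, hv, hu⟩)
      · exact ⟨[], w, rfl, hw, p, rfl, hp⟩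
      · exact ⟨c :: u, v, rfl, hv, by simpa using hu⟩
    · rintro ⟨u, v, h, hv, b, hb, hba⟩
      rcases u with - | ⟨d, u⟩
      · obtain ⟨rfl, rfl⟩ := List.cons.inj h
        obtain rfl : p = b := by simpa using hb
        exact .inl ⟨rfl, hba, hv⟩
      · obtain ⟨rfl, rfl⟩ := List.cons.inj h
        exact .inr ⟨u, v, rfl, hv, b, by simpa using hb, hba⟩

theorem minima_sublist (p : ℕ) (w : List ℕ) : (minima p w).Sublist w := by
  induction w generalizing p with
  | nil => exact List.Sublist.refl _
  | cons a w ih =>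
    rw [minima]
    split_ifs
    · exact (ih a).cons_cons a
    · exact (ih a).cons a

theorem ncard_freeMinima_cons {w : List ℕ} {p : ℕ} (hn : (p :: w).Nodup) :
    (freeMinima (p :: w)).ncard = (minima p w).length := by
  have : freeMinima (p :: w) = ↑(minima p w).toFinset := by
    ext a
    rw [Finset.mem_coe, List.mem_toFinset, mem_minima_iff]
    constructor
    · rintro ⟨⟨u, v, h, hv⟩, hD⟩
      rcases u with - | ⟨c, u⟩
      · exact absurd ⟨[], v, h, .inl rfl⟩ hD
      · obtain ⟨rfl, rfl⟩ := List.cons.inj h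
        refine ⟨u, v, rfl, hv, (p :: u).getLast (by simp), List.getLast?_eq_getLast_of_ne_nil _, ?_⟩
        by_contra hlt
        have hne : (p :: u).getLast (by simp) ≠ a := fun e => by
          rw [h, List.nodup_append] at hn
          exact hn.2.2 _ (List.getLast_mem _) a (by simp) e
        exact hD ⟨p :: u, v, h, .inr ⟨_, List.getLast?_eq_getLast_of_ne_nil _, by omega⟩⟩
    · rintro ⟨u, v, rfl, hv, b, hb, hba⟩
      refine ⟨⟨p :: u, v, rfl, hv⟩, ?_⟩
      rintro ⟨u', v', h', hu'⟩
      obtain ⟨rfl, -⟩ := append_cons_inj_of_nodup (u := p :: u) hn h'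
      simp only [hb, Option.some.injEq, exists_eq_left', reduceCtorEq, false_or] at hu'
      omega
  rw [this, Set.ncard_coe_finset, List.toFinset_card_of_nodup]
  exact (List.nodup_cons.1 hn).2.sublist (minima_sublist p w)

/-- The flattenings of the members of `U(n + 1, k; 321)`. -/
def flattenings (n k : ℕ) : Set (List ℕ) :=
  {w | w.Perm (List.range' 1 (n + 1)) ∧ Avoids321 w ∧
    (∀ a, IsDescentTerminator w a → IsRLMin w a) ∧ (freeMinima w).ncard = k}

theorem flattenings_eq (n k : ℕ) :
    flattenings n k = List.cons 1 '' {w ∈ words 2 n 0 | (minima 0 w).length = k} := by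
  have key : ∀ w : List ℕ, w.Perm (List.range' 2 n) →
      (1 :: w).Nodup ∧ (∀ a ∈ w, 1 < a) ∧ (freeMinima (1 :: w)).ncard = (minima 0 w).length := by
    intro w hw
    have h1 := lt_of_perm_range' hw
    have hn : (1 :: w).Nodup := List.nodup_cons.2
      ⟨fun h => (h1 1 h).false, hw.nodup_iff.2 List.nodup_range'⟩
    refine ⟨hn, h1, ?_⟩
    rw [ncard_freeMinima_cons hn, minima_congr (q := 0) fun a ha => ⟨h1 a ha, (h1 a ha).pos⟩]
  have hperm : ∀ w : List ℕ, (1 :: w).Perm (List.range' 1 (n + 1)) ↔ w.Perm (List.range' 2 n) :=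
    fun w => perm_range'_succ_iff (s := [])
  have havoid : ∀ w : List ℕ, (∀ a ∈ w, 1 < a) → (Avoids321 (1 :: w) ↔ Avoids321 w) :=
    fun w h => (avoids321_insert (s := []) (by simpa using h)).trans (by simp)
  ext w
  simp only [flattenings, words, Set.mem_ofPred_eq, Set.mem_image]
  constructor
  · rintro ⟨hp, ha, hD, hk⟩
    cases w with
    | nil => simpa using hp.length_eq
    | cons a w =>
      obtain ⟨u, v, h, hv⟩ := hD a ⟨[], w, rfl, .inl rfl⟩
      have hn : (a :: w).Nodup := hp.nodup_iff.2 List.nodup_range'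
      obtain ⟨-, rfl⟩ := append_cons_inj_of_nodup (u := []) hn h
      have h1 : 1 ∈ a :: w := hp.mem_iff.2 (by simp)
      have ha1 : 1 ≤ a := (List.mem_range'_1.1 (hp.mem_iff.1 List.mem_cons_self)).1
      obtain rfl : a = 1 := by
        rcases List.mem_cons.1 h1 with h | h
        · exact h.symm
        · have := hv 1 h
          omega
      obtain ⟨-, hlt, hcard⟩ := key w ((hperm w).1 hp)
      exact ⟨w, ⟨⟨(hperm w).1 hp, (havoid w hlt).1 ha, by simp, by simp⟩, hcard ▸ hk⟩, rfl⟩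
  · rintro ⟨w, ⟨⟨hp, ha, -, -⟩, hk⟩, rfl⟩
    obtain ⟨hn, hlt, hcard⟩ := key w hp
    have ha' := (havoid w hlt).2 ha
    exact ⟨(hperm w).2 hp, ha', fun a => isRLMin_of_isDescentTerminator hn hlt ha', hcard.trans hk⟩

/-- A flattening counted by `U(n + 1, k; 321)` comes from `2 ^ k` partitions. -/
theorem ncard_UM (n k : ℕ) :
    (UM (n + 1) k [3, 2, 1]).ncard = 2 ^ k * {l ∈ codes n | l.count 1 = k}.ncard := by
  rw [← ncard_words 2 n k two_pos, ← List.cons_injective.injOn.ncard_image, ← flattenings_eq]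
  have hU : ∀ P : Finpartition (interval (n + 1)),
      P ∈ UM (n + 1) k [3, 2, 1] ↔ flatten P ∈ flattenings n k := fun P => by
    have hD : ∀ a, IsDescentTerminator (flatten P) a → IsRLMin (flatten P) a := fun a ha =>
      isRLMin_initiators P (mem_initiators_of_isDescentTerminator P ha)
    simp only [UM, U, Set.mem_ofPred_eq, contains_321_iff, not_not, flattenings]
    exact ⟨fun h => ⟨flatten_perm P, h.1, hD, h.2⟩, fun h => ⟨h.2.1, h.2.2.2⟩⟩
  refine Set.ncard_eq_mul_of_fibers (Set.toFinite _) ?_ (f := flatten) (fun P hP => (hU P).1 hP) ?_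
  · refine (List.range' 1 (n + 1)).permutations.toFinset.finite_toSet.subset fun w hw => ?_
    simpa using hw.1
  · intro w hw
    rw [← congrArg (2 ^ ·) hw.2.2.2, ← ncard_flatten_eq hw.1 hw.2.2.1]
    congr 1
    ext P
    exact ⟨fun h => h.2, fun h => ⟨(hU P).2 (by rwa [show flatten P = w from h]), h⟩⟩

theorem ncard_UM_eq_riordan {n k : ℕ} (hk : k ≤ n) :
    ((UM (n + 1) k [3, 2, 1]).ncard : ℤ) = (n.choose k : ℤ) * 2 ^ k * riordan (n - k) := by
  rw [ncard_UM, ncard_codes_count_one hk, ← ncard_codes_no_one]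
  push_cast
  ring

theorem ncard_M_le {n : ℕ} (P : Finpartition (interval (n + 1))) : (M P).ncard ≤ n := by
  have hp := flatten_perm P
  have hn := nodup_flatten P
  change (freeMinima (flatten P)).ncard ≤ n
  cases hw : flatten P with
  | nil => simp [hw] at hp
  | cons a w =>
    rw [hw] at hp hn
    rw [ncard_freeMinima_cons hn]
    refine (minima_sublist a w).length_le.trans ?_
    have := hp.length_eq
    simp at this
    omega

end FlattenedPartition

theorem mainTheorem2 (n : ℕ) :
    (FlattenedPartition.U (n + 1) [3, 2, 1]).ncard
        = ∑ k ∈ Finset.range (n + 1), n.choose k * catalan k ∧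
    (∀ k : ℕ, k ≤ n →
      ((FlattenedPartition.UM (n + 1) k [3, 2, 1]).ncard : ℤ)
        = (n.choose k : ℤ) * 2 ^ k * FlattenedPartition.riordan (n - k)) ∧
    (FlattenedPartition.UM (n + 1) 0 [3, 2, 1]).ncard
        = (FlattenedPartition.noShortDescentPaths n).ncard ∧
    ∑ k ∈ Finset.range (n + 1), (n.choose k : ℤ) * 2 ^ k * FlattenedPartition.riordan (n - k)
        = ∑ k ∈ Finset.range (n + 1), (n.choose k : ℤ) * (catalan k : ℤ) := by
  refine ⟨?_, fun k hk => FlattenedPartition.ncard_UM_eq_riordan hk, ?_,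
    FlattenedPartition.sum_choose_mul_two_pow_mul_riordan n⟩
  · rw [Set.ncard_eq_sum_range (Set.toFinite _) (f := fun P => (FlattenedPartition.M P).ncard)
      fun P _ => FlattenedPartition.ncard_M_le P]
    have h := FlattenedPartition.sum_choose_mul_two_pow_mul_riordan n
    rw [Finset.sum_congr rfl fun k hk => (FlattenedPartition.ncard_UM_eq_riordan
      (Nat.lt_succ_iff.1 (Finset.mem_range.1 hk))).symm] at h
    exact_mod_cast h
  · rw [FlattenedPartition.ncard_UM, BallotCode.ncard_noShortDescentPaths, pow_zero, one_mul]
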